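/- Let $\mathcal M$ be a smooth manifold of dimension $n+m$ with a smooth Riemannian metric $\langle\cdot,\cdot\rangle$ and a foliation with $m$-dimensional leaves. The foliation is not assumed to be bundle-like or totally geodesic. Let $\mathcal V\subset T\mathcal M$ be the bundle tangent to the leaves (vertical), $\mathcal H=\mathcal V^\perp$ (horizontal), let $\nabla f$ be the Riemannian gradient of a function $f$ and $\nabla_{\mathcal V}f$ its vertical part. Let $\Delta_{\mathcal V}$ be the vertical Laplacian, that is, the Laplace–Beltrami operator of the leaves with the induced metric; in a local orthonormal frame $Z_1,\dots,Z_m$ of $\mathcal V$ it is $\Delta_{\mathcal V}=\sum_\alpha Z_\alpha^2-\sum_{\alpha,\beta}\langle[Z_\alpha,Z_\beta],Z_\beta\rangle Z_\alpha$. Let $Y$ be a smooth vector field, $\mathcal L=\Delta_{\mathcal V}+Y$, and $$\Gamma(f,g)=\langle\nabla_{\mathcal V}f,\nabla_{\mathcal V}g\rangle,\qquad \Gamma_2(f,g)=\tfrac12\bigl(\mathcal L\Gamma(f,g)-\Gamma(g,\mathcal Lf)-\Gamma(f,\mathcal Lg)\bigr),\qquad \Gamma_2(f)=\Gamma_2(f,f).$$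 Let $\nabla$ be the Hladky connection of the foliation. Of its properties only the following are used, and the result holds for every smooth connection on $T\mathcal M$ that has them: $\nabla$ is metric, $\nabla U$ is horizontal for every horizontal field $U$ and vertical for every vertical field $U$, and its torsion $T$ satisfies $T(U,V)=0$ for $U,V$ vertical and $T(U,V)=-[U,V]_{\mathcal V}$ (the vertical part) for $U,V$ horizontal. Let $R(U,V)=[\nabla_U,\nabla_V]-\nabla_{[U,V]}$ be the curvature of $\nabla$, let $\mathbf{Ric}(U,V)$ be the trace of $W\mapsto R(W,U)V$ on the tangent space, let $\nabla Y(U,V)=\langle\nabla_UY,V\rangle$, and let $\nabla^2_{\mathcal V}f$ be the vertical Hessian, the bilinear form with $\nabla^2_{\mathcal V}f(U,V)=\langle\nabla_U\nabla_{\mathcal V}f,V\rangle$ for $U,V$ vertical and $\nabla^2_{\mathcal V}f(U,V)=0$ if $U$ or $V$ is horizontal, with Hilbert–Schmidt norm $\|\nabla^2_{\mathcal V}f\|$. Then for every $f\in C^\infty(\mathcal M)$ (in particular for every $f\in C_0^\infty(\mathcal M)$), everywhere on $\mathcal M$, $$\Gamma_2(f)=\|\nabla^2_{\mathcal V}f\|^2+\mathbf{Ric}(\nabla_{\mathcal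 V}f,\nabla_{\mathcal V}f)-\nabla Y(\nabla_{\mathcal V}f,\nabla f)-\langle T(Y,\nabla_{\mathcal V}f),\nabla f\rangle .$$ -/

import Mathlib

open Bundle Manifold
open scoped ContDiff

noncomputable section

/- Throughout, `M` is a smooth manifold without boundary modelled on a finite-dimensional real vector
space `E`, and the tangent spaces carry a smooth Riemannian metric `⟨·,·⟩ = inner ℝ · ·`. -/

namespace KolmogorovFoliation

section Metric

variable {E : Type*} [NormedAddCommGroup E] [NormedSpace ℝ E] [FiniteDimensional ℝ E]
  {M : Type*} [TopologicalSpace M] [ChartedSpace E M]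

instance finiteDimensionalTangentSpace (x : M) :
    FiniteDimensional ℝ (TangentSpace 𝓘(ℝ, E) x) :=
  inferInstanceAs (FiniteDimensional ℝ E)

variable [RiemannianBundle (fun x : M ↦ TangentSpace 𝓘(ℝ, E) x)]

instance completeTangentSpace (x : M) : CompleteSpace (TangentSpace 𝓘(ℝ, E) x) :=
  FiniteDimensional.complete ℝ _

/-- The Riemannian gradient `∇f`: the vector dual to the differential `df`. -/
def gradient (f : M → ℝ) (x : M) : TangentSpace 𝓘(ℝ, E) x :=
  (InnerProductSpace.toDual ℝ (TangentSpace 𝓘(ℝ, E) x)).symm (mvfderiv 𝓘(ℝ, E) f x)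

/-- The Lie derivative of the metric,
`(𝓛_X g)(Z, W) = X⟨Z, W⟩ - ⟨[X, Z], W⟩ - ⟨Z, [X, W]⟩`. -/
def lieDerivMetric (X Z W : Π x : M, TangentSpace 𝓘(ℝ, E) x) (x : M) : ℝ :=
  mvfderiv 𝓘(ℝ, E) (fun y ↦ inner ℝ (Z y) (W y)) x (X x)
    - inner ℝ (VectorField.mlieBracket 𝓘(ℝ, E) X Z x) (W x)
    - inner ℝ (Z x) (VectorField.mlieBracket 𝓘(ℝ, E) X W x)

end Metric

section Curvature

variable {E : Type*} [NormedAddCommGroup E] [NormedSpace ℝ E] [FiniteDimensional ℝ E]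
  {M : Type*} [TopologicalSpace M] [ChartedSpace E M] [IsManifold 𝓘(ℝ, E) ∞ M]

/-- The curvature `R(X, Y)Z = ∇_X ∇_Y Z - ∇_Y ∇_X Z - ∇_{[X, Y]} Z` of a connection `∇` on `TM`.
In Mathlib's notation `∇_u Z` at the point `x` is `cov Z x u`. -/
def curvature (cov : CovariantDerivative 𝓘(ℝ, E) E (TangentSpace 𝓘(ℝ, E) : M → Type _))
    (X Y Z : Π x : M, TangentSpace 𝓘(ℝ, E) x) (x : M) : TangentSpace 𝓘(ℝ, E) x :=
  cov (fun y ↦ cov Z y (Y y)) x (X x) - cov (fun y ↦ cov Z y (X y)) x (Y x)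
    - cov Z x (VectorField.mlieBracket 𝓘(ℝ, E) X Y x)

variable [RiemannianBundle (fun x : M ↦ TangentSpace 𝓘(ℝ, E) x)]

/-- The Ricci curvature `Ric(u, v)` of a connection: the trace of the endomorphism
`w ↦ R(w, u)v` of `T_x M`, computed in an orthonormal basis. The curvature is tensorial, so it is
evaluated on vectors by extending these to vector fields that are smooth near `x`. -/
def ricci (cov : CovariantDerivative 𝓘(ℝ, E) E (TangentSpace 𝓘(ℝ, E) : M → Type _))
    (x : M) (u v : TangentSpace 𝓘(ℝ, E) x) : ℝ :=
  ∑ i, inner ℝ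
    (curvature cov
      (FiberBundle.extend E (stdOrthonormalBasis ℝ (TangentSpace 𝓘(ℝ, E) x) i))
      (FiberBundle.extend E u) (FiberBundle.extend E v) x)
    (stdOrthonormalBasis ℝ (TangentSpace 𝓘(ℝ, E) x) i)

end Curvature

/-- A foliation of `M` with `m`-dimensional leaves and codimension `n`, given by the tangent spaces
`vert x` of the leaves. These form a smooth subbundle of rank `m` of `TM`, and locally the leaves
are the level sets of a smooth map to `ℝⁿ`: the subbundle is the kernel of its differential. -/
structure Foliation (E : Type*) [NormedAddCommGroup E] [NormedSpace ℝ E]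
    (M : Type*) [TopologicalSpace M] [ChartedSpace E M] [IsManifold 𝓘(ℝ, E) ∞ M] (n m : ℕ) where
  /-- The vertical space at `x`, that is, the tangent space of the leaf through `x`. -/
  vert : ∀ x : M, Submodule ℝ (TangentSpace 𝓘(ℝ, E) x)
  /-- Around every point there is a smooth frame of vertical vector fields `Z_1, …, Z_m`. -/
  exists_frame : ∀ x₀ : M, ∃ U : Set M, IsOpen U ∧ x₀ ∈ U ∧
    ∃ Z : Fin m → Π x : M, TangentSpace 𝓘(ℝ, E) x,
      (∀ α, CMDiff[U] ∞ (T% (Z α))) ∧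
      ∀ x ∈ U, LinearIndependent ℝ (fun α ↦ Z α x) ∧
        Submodule.span ℝ (Set.range fun α ↦ Z α x) = vert x
  /-- Around every point the leaves are the fibres of a smooth map to `ℝⁿ`. -/
  integrable : ∀ x₀ : M, ∃ U : Set M, IsOpen U ∧ x₀ ∈ U ∧
    ∃ φ : M → (Fin n → ℝ), ContMDiffOn 𝓘(ℝ, E) 𝓘(ℝ, Fin n → ℝ) ∞ φ U ∧
      ∀ x ∈ U, vert x = (mvfderiv 𝓘(ℝ, E) φ x).ker

section Foliated

variable {E : Type*} [NormedAddCommGroup E] [NormedSpace ℝ E] [FiniteDimensional ℝ E]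
  {M : Type*} [TopologicalSpace M] [ChartedSpace E M] [IsManifold 𝓘(ℝ, E) ∞ M]
  [RiemannianBundle (fun x : M ↦ TangentSpace 𝓘(ℝ, E) x)]
  {n m : ℕ} (F : Foliation E M n m)

/-- The horizontal space at `x`: the orthogonal complement of the vertical space. -/
def Foliation.hor (x : M) : Submodule ℝ (TangentSpace 𝓘(ℝ, E) x) := (F.vert x)ᗮ

/-- The vertical part of a tangent vector: its orthogonal projection to the vertical space. -/
def Foliation.vertPart (x : M) (u : TangentSpace 𝓘(ℝ, E) x) : TangentSpace 𝓘(ℝ, E) x :=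
  (F.vert x).starProjection u

/-- The vertical gradient `∇_𝒱 f`: the vertical part of the gradient. -/
def Foliation.vertGrad (f : M → ℝ) (x : M) : TangentSpace 𝓘(ℝ, E) x :=
  F.vertPart x (gradient f x)

/-- The divergence along the leaves of a vector field `X` tangent to the leaves: half of the trace
over the vertical space of the Lie derivative `𝓛_X g` of the metric. The latter is tensorial, so it
is evaluated on vectors by extending these to vector fields that are smooth near `x`. -/
def Foliation.vertDiv (X : Π x : M, TangentSpace 𝓘(ℝ, E) x) (x : M) : ℝ :=
  (1 / 2) * ∑ α, lieDerivMetric X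
    (FiberBundle.extend E (stdOrthonormalBasis ℝ (F.vert x) α : TangentSpace 𝓘(ℝ, E) x))
    (FiberBundle.extend E (stdOrthonormalBasis ℝ (F.vert x) α : TangentSpace 𝓘(ℝ, E) x)) x

/-- The vertical Laplacian `Δ_𝒱`, that is, the Laplace-Beltrami operator of the leaves: the
divergence along the leaves of the vertical gradient. In a local orthonormal frame `Z_1, …, Z_m` of
vertical fields it is `∑_α Z_α² - ∑_{α, β} ⟨[Z_α, Z_β], Z_β⟩ Z_α`. -/
def Foliation.vertLaplacian (f : M → ℝ) (x : M) : ℝ :=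
  F.vertDiv (F.vertGrad f) x

/-- The operator `ℒ = Δ_𝒱 + Y`. -/
def Foliation.kolmogorov (Y : Π x : M, TangentSpace 𝓘(ℝ, E) x) (f : M → ℝ) (x : M) : ℝ :=
  F.vertLaplacian f x + mvfderiv 𝓘(ℝ, E) f x (Y x)

/-- `Γ(f, g) = ⟨∇_𝒱 f, ∇_𝒱 g⟩`. -/
def Foliation.gamma (f g : M → ℝ) (x : M) : ℝ :=
  inner ℝ (F.vertGrad f x) (F.vertGrad g x)

/-- `Γ₂(f, g) = ½ (ℒ Γ(f, g) - Γ(g, ℒ f) - Γ(f, ℒ g))`. -/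
def Foliation.gamma₂ (Y : Π x : M, TangentSpace 𝓘(ℝ, E) x) (f g : M → ℝ) (x : M) : ℝ :=
  (1 / 2) * (F.kolmogorov Y (F.gamma f g) x
    - F.gamma g (F.kolmogorov Y f) x - F.gamma f (F.kolmogorov Y g) x)

/-- The vertical Hessian `∇²_𝒱 f(u, v)` with respect to a connection `∇`. It is `⟨∇_u ∇_𝒱 f, v⟩` if
`u` and `v` are vertical, and `0` if one of them is horizontal. -/
def Foliation.vertHessian
    (cov : CovariantDerivative 𝓘(ℝ, E) E (TangentSpace 𝓘(ℝ, E) : M → Type _))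
    (f : M → ℝ) (x : M) (u v : TangentSpace 𝓘(ℝ, E) x) : ℝ :=
  inner ℝ (cov (F.vertGrad f) x (F.vertPart x u)) (F.vertPart x v)

/-- The squared Hilbert-Schmidt norm `‖∇²_𝒱 f‖²` of the vertical Hessian. -/
def Foliation.vertHessianNormSq
    (cov : CovariantDerivative 𝓘(ℝ, E) E (TangentSpace 𝓘(ℝ, E) : M → Type _))
    (f : M → ℝ) (x : M) : ℝ :=
  ∑ i, ∑ j, F.vertHessian cov f x
    (stdOrthonormalBasis ℝ (TangentSpace 𝓘(ℝ, E) x) i)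
    (stdOrthonormalBasis ℝ (TangentSpace 𝓘(ℝ, E) x) j) ^ 2

/-- The defining properties of the Hladky connection of the foliation: it is a smooth metric
connection for which the horizontal and the vertical bundle are parallel, with torsion `T(U, V) = 0`
for vertical `U, V` and `T(U, V) = -[U, V]_𝒱` for horizontal fields `U, V`. Nothing is required of
the torsion `T(Z, X)` of a vertical and a horizontal vector. -/
structure Foliation.IsHladkyConnection
    (cov : CovariantDerivative 𝓘(ℝ, E) E (TangentSpace 𝓘(ℝ, E) : M → Type _)) : Prop where
  smooth : ∀ (O : Set M), IsOpen O → ∀ U W : Π x : M, TangentSpace 𝓘(ℝ, E) x,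
    CMDiff[O] ∞ (T% U) → CMDiff[O] ∞ (T% W) → CMDiff[O] ∞ (T% (fun x ↦ cov W x (U x)))
  metric : ∀ (O : Set M), IsOpen O → ∀ V W : Π x : M, TangentSpace 𝓘(ℝ, E) x,
    CMDiff[O] ∞ (T% V) → CMDiff[O] ∞ (T% W) → ∀ x ∈ O, ∀ u,
    mvfderiv 𝓘(ℝ, E) (fun y ↦ inner ℝ (V y) (W y)) x u
      = inner ℝ (cov V x u) (W x) + inner ℝ (V x) (cov W x u)
  parallel_hor : ∀ (O : Set M), IsOpen O → ∀ W : Π x : M, TangentSpace 𝓘(ℝ, E) x,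
    CMDiff[O] ∞ (T% W) → (∀ x ∈ O, W x ∈ F.hor x) → ∀ x ∈ O, ∀ u, cov W x u ∈ F.hor x
  parallel_vert : ∀ (O : Set M), IsOpen O → ∀ W : Π x : M, TangentSpace 𝓘(ℝ, E) x,
    CMDiff[O] ∞ (T% W) → (∀ x ∈ O, W x ∈ F.vert x) → ∀ x ∈ O, ∀ u, cov W x u ∈ F.vert x
  torsion_vert : ∀ x, ∀ u ∈ F.vert x, ∀ v ∈ F.vert x, cov.torsion x u v = 0
  torsion_hor : ∀ (O : Set M), IsOpen O → ∀ U V : Π x : M, TangentSpace 𝓘(ℝ, E) x,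
    CMDiff[O] ∞ (T% U) → CMDiff[O] ∞ (T% V) →
    (∀ x ∈ O, U x ∈ F.hor x) → (∀ x ∈ O, V x ∈ F.hor x) →
    ∀ x ∈ O, cov.torsion x (U x) (V x)
      = - F.vertPart x (VectorField.mlieBracket 𝓘(ℝ, E) U V x)

end Foliated

end KolmogorovFoliation

end

set_option linter.unusedSectionVars false

/-! Write `X` for the vertical gradient of `f`. Since `Γ(f, g) = X g`, `Γ₂(f)` splits into a
leafwise part, `½ Δ_𝒱 Γ(f, f) - X (Δ_𝒱 f)`, and a drift part, `½ Y Γ(f, f) - X (Y f)`.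

Leafwise part (`bochner`): the torsion vanishes on vertical vectors, so the vertical Hessian is
symmetric (`inner_cov_vertGrad_symm`), whence `∇_𝒱 Γ(f, f) = 2 ∇_X X` (`vertGrad_gamma`). In a
vertical orthonormal frame `Z_a`, commuting `∇_{Z_a}` with `∇_X` produces the curvature and
`∇_{[Z_a, X]} X`. The curvature terms sum to Ricci, because `R(·, X)X` is vertical
(`ricci_self_eq_sum`). In the rest, the derivatives `∇_X Z_a` form an antisymmetric matrix and drop
out against the symmetric Hessian, leaving its squared norm (`sum_inner_sub_eq_sum_sq`).

Drift part (`mvfderiv_mvfderiv_vertGrad`): `X (Y f) = Y (X f) - [Y, X] f`, and the bracket is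
expanded by the torsion. As `∇_Y X` is vertical, its pairing with `∇f` is `½ Y Γ(f, f)`; it cancels,
and only `∇_X Y` and `T(Y, X)` remain. -/

namespace KolmogorovFoliation

open Filter Topology VectorField

/-! ### Germs of smooth functions and vector fields. -/

section SmoothFields

variable {E : Type*} [NormedAddCommGroup E] [NormedSpace ℝ E]
  {M : Type*} [TopologicalSpace M] [ChartedSpace E M]

/-- A function is smooth near `x` if it is smooth at all points close to `x`. -/
def SmoothFunNear (f : M → ℝ) (x : M) : Prop := ∀ᶠ y in 𝓝 x, CMDiffAt ∞ f y

lemma SmoothFunNear.mdifferentiableAt {f : M → ℝ} {x : M}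
    (hf : SmoothFunNear (E := E) f x) : MDiffAt f x :=
  hf.self_of_nhds.mdifferentiableAt (by simp)

variable [IsManifold 𝓘(ℝ, E) ∞ M]

/-- A vector field is smooth near `x` if it is smooth at all points close to `x`. -/
def SmoothNear (V : Π x : M, TangentSpace 𝓘(ℝ, E) x) (x : M) : Prop :=
  ∀ᶠ y in 𝓝 x, CMDiffAt ∞ (T% V) y

variable {f g : M → ℝ} {U V W V' : Π x : M, TangentSpace 𝓘(ℝ, E) x} {x : M}

lemma SmoothNear.mdifferentiableAt (hV : SmoothNear V x) : MDiffAt (T% V) x :=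
  hV.self_of_nhds.mdifferentiableAt (by simp)

lemma SmoothNear.congr (hV : SmoothNear V x) (h : V' =ᶠ[𝓝 x] V) : SmoothNear V' x := by
  filter_upwards [hV, h.eventuallyEq_nhds] with y hy hy'
  refine hy.congr_of_eventuallyEq ?_
  filter_upwards [hy'] with z hz
  simp [hz]

lemma SmoothNear.add (hV : SmoothNear V x) (hW : SmoothNear W x) :
    SmoothNear (V + W) x := by
  filter_upwards [hV, hW] with y h1 h2 using h1.add_section h2

lemma SmoothNear.sub (hV : SmoothNear V x) (hW : SmoothNear W x) :
    SmoothNear (V - W) x := by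
  filter_upwards [hV, hW] with y h1 h2 using h1.sub_section h2

lemma SmoothNear.smul (hf : SmoothFunNear (E := E) f x) (hW : SmoothNear W x) :
    SmoothNear (f • W) x := by
  filter_upwards [hf, hW] with y h1 h2 using h1.smul_section h2

lemma SmoothNear.sum {ι : Type*} (s : Finset ι) {Z : ι → Π x : M, TangentSpace 𝓘(ℝ, E) x}
    (h : ∀ i ∈ s, SmoothNear (Z i) x) : SmoothNear (fun y ↦ ∑ i ∈ s, Z i y) x := by
  have : ∀ᶠ y in 𝓝 x, ∀ i ∈ s, CMDiffAt ∞ (T% (Z i)) y := by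
    rw [Filter.eventually_all_finset]
    exact h
  filter_upwards [this] with y hy using .sum_section hy

lemma SmoothNear.eventually (hV : SmoothNear V x) : ∀ᶠ y in 𝓝 x, SmoothNear V y :=
  hV.eventually_nhds

lemma smoothNear_extend [FiniteDimensional ℝ E] (v : TangentSpace 𝓘(ℝ, E) x) :
    SmoothNear (FiberBundle.extend E v) x := by
  obtain ⟨s, hs, h⟩ := FiberBundle.exists_contMDiffOn_extend (k := ∞) 𝓘(ℝ, E) E v
  filter_upwards [eventually_mem_nhds_iff.2 hs] with y hy using h.contMDiffAt hy

lemma SmoothNear.mlieBracket [CompleteSpace E] (hV : SmoothNear V x) (hW : SmoothNear W x) :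
    SmoothNear (mlieBracket 𝓘(ℝ, E) V W) x := by
  have : IsManifold 𝓘(ℝ, E) (minSmoothness ℝ 2) M := by
    simpa using inferInstanceAs (IsManifold 𝓘(ℝ, E) 2 M)
  have : IsManifold 𝓘(ℝ, E) (((⊤ : ℕ∞) : ℕ∞ω) + 1) M := by simpa
  filter_upwards [hV, hW] with y h1 h2
  exact ContMDiffAt.mlieBracket_vectorField (n := ⊤) (m := ⊤) h1 h2 (by simp)

end SmoothFields

/-! ### Derivatives of functions along fields, and the Lie bracket as a commutator. -/

section Inner
variable {E : Type*} [NormedAddCommGroup E] [NormedSpace ℝ E]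
  {M : Type*} [TopologicalSpace M] [ChartedSpace E M]
  [IsManifold 𝓘(ℝ, E) ∞ M]
  [RiemannianBundle (fun x : M ↦ TangentSpace 𝓘(ℝ, E) x)]
  [IsContMDiffRiemannianBundle 𝓘(ℝ, E) ∞ E (fun x : M ↦ TangentSpace 𝓘(ℝ, E) x)]
variable {f g : M → ℝ} {U V W V' : Π x : M, TangentSpace 𝓘(ℝ, E) x} {x : M}

lemma SmoothNear.inner (hV : SmoothNear V x) (hW : SmoothNear W x) :
    SmoothFunNear (E := E) (fun y ↦ inner ℝ (V y) (W y)) x := by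
  filter_upwards [hV, hW] with y h1 h2
  exact ContMDiffAt.inner_bundle (F := E) (E := fun x ↦ TangentSpace 𝓘(ℝ, E) x) (b := id) h1 h2

/-- The product rule `[V, fW] = (Vf) W + f [V, W]` is solved for `Vf` by pairing with a field `W`
that does not vanish near `x`; the result is a quotient of smooth functions. -/
lemma SmoothFunNear.mvfderiv [FiniteDimensional ℝ E] (hf : SmoothFunNear (E := E) f x)
    (hV : SmoothNear V x) :
    SmoothFunNear (E := E) (fun y ↦ mvfderiv 𝓘(ℝ, E) f y (V y)) x := by
  rcases subsingleton_or_nontrivial E with hE | hE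
  -- In dimension zero there is no nonvanishing `W`, but every tangent vector is zero.
  · have : (fun y ↦ _root_.mvfderiv 𝓘(ℝ, E) f y (V y)) = fun y ↦ 0 := by
      ext y
      have : V y = 0 := Subsingleton.elim (α := E) _ _
      simp [this]
    rw [this]
    exact Filter.Eventually.of_forall fun y ↦ contMDiffAt_const
  obtain ⟨w, hw⟩ := exists_ne (0 : E)
  let w' : TangentSpace 𝓘(ℝ, E) x := w
  have hw' : w' ≠ 0 := hw
  have hW := smoothNear_extend w'
  set W := FiberBundle.extend E w'
  have h1 := (hV.mlieBracket (hW.smul hf)).sub ((hV.mlieBracket hW).smul hf)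
  have hWx : W x ≠ 0 := by simpa [W] using hw'
  have hc : ContinuousAt (fun y ↦ inner ℝ (W y) (W y)) x :=
    (hW.inner hW).self_of_nhds.continuousAt
  have h0 : ∀ᶠ y in 𝓝 x, inner ℝ (W y) (W y) ≠ 0 :=
    hc.eventually_ne (by simpa using hWx)
  have h2 := h1.inner hW
  have h3 := hW.inner hW
  have heq : (fun y ↦ _root_.mvfderiv 𝓘(ℝ, E) f y (V y)) =ᶠ[𝓝 x] fun y ↦
      inner ℝ ((VectorField.mlieBracket 𝓘(ℝ, E) V (f • W) -
        f • VectorField.mlieBracket 𝓘(ℝ, E) V W) y) (W y) / inner ℝ (W y) (W y) := by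
    filter_upwards [h0, hf, hW] with y hy hfy hWy
    have := mlieBracket_smul_right (I := 𝓘(ℝ, E)) (V := V) (hfy.mdifferentiableAt (by simp))
      (hWy.mdifferentiableAt (by simp))
    rw [Pi.sub_apply, this]
    simp only [Pi.smul_apply', add_sub_cancel_right, inner_smul_left]
    rw [mul_div_assoc, div_self hy]
    simp
  filter_upwards [h2, h3, h0, heq.eventuallyEq_nhds] with y h2 h3 h0 heq
  exact (h2.div₀ h3 h0).congr_of_eventuallyEq heq

/-- The Jacobi identity for `U`, `V`, `fW`, expanded by the product rule, contains the commutator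
identity as its coefficient of `W`. -/
lemma mvfderiv_mlieBracket [FiniteDimensional ℝ E] (hf : SmoothFunNear (E := E) f x)
    (hU : SmoothNear U x) (hV : SmoothNear V x) :
    mvfderiv 𝓘(ℝ, E) f x (mlieBracket 𝓘(ℝ, E) U V x) =
      mvfderiv 𝓘(ℝ, E) (fun y ↦ mvfderiv 𝓘(ℝ, E) f y (V y)) x (U x) -
      mvfderiv 𝓘(ℝ, E) (fun y ↦ mvfderiv 𝓘(ℝ, E) f y (U y)) x (V x) := by
  have hE : ∀ (y : M) (u : TangentSpace 𝓘(ℝ, E) y), Subsingleton E → u = 0 := fun y u h ↦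
    Subsingleton.elim (α := E) _ _
  rcases subsingleton_or_nontrivial E with h | h
  · rw [hE _ (mlieBracket 𝓘(ℝ, E) U V x) h, hE _ (U x) h, hE _ (V x) h]
    simp
  obtain ⟨w, hw⟩ := exists_ne (0 : E)
  let w' : TangentSpace 𝓘(ℝ, E) x := w
  have hw' : w' ≠ 0 := hw
  have hW := smoothNear_extend w'
  set W := FiberBundle.extend E w'
  have hWx : W x ≠ 0 := by simpa [W] using hw'
  have key : ∀ V : Π x : M, TangentSpace 𝓘(ℝ, E) x,
      mlieBracket 𝓘(ℝ, E) V (f • W) =ᶠ[𝓝 x]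
        (fun y ↦ mvfderiv 𝓘(ℝ, E) f y (V y)) • W
          + f • mlieBracket 𝓘(ℝ, E) V W := by
    intro V
    filter_upwards [hf, hW] with y hfy hWy
    exact mlieBracket_smul_right (I := 𝓘(ℝ, E)) (V := V) (hfy.mdifferentiableAt (by simp))
      (hWy.mdifferentiableAt (by simp))
  have : IsManifold 𝓘(ℝ, E) (minSmoothness ℝ 3) M := by
    simpa using inferInstanceAs (IsManifold 𝓘(ℝ, E) 3 M)
  have htwo : (2 : ℕ∞ω) ≤ ∞ := ENat.LEInfty.out
  have jac : ∀ {W : Π x : M, TangentSpace 𝓘(ℝ, E) x}, SmoothNear W x →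
      mlieBracket 𝓘(ℝ, E) U (mlieBracket 𝓘(ℝ, E) V W) x =
      mlieBracket 𝓘(ℝ, E) (mlieBracket 𝓘(ℝ, E) U V) W x +
      mlieBracket 𝓘(ℝ, E) V (mlieBracket 𝓘(ℝ, E) U W) x := fun {W} hW ↦
    leibniz_identity_mlieBracket_apply (I := 𝓘(ℝ, E)) (U := U) (V := V) (W := W) (x := x)
    (hU.self_of_nhds.of_le (by simpa using htwo))
    (hV.self_of_nhds.of_le (by simpa using htwo))
    (hW.self_of_nhds.of_le (by simpa using htwo))
  have expand : ∀ {U V : Π x : M, TangentSpace 𝓘(ℝ, E) x}, SmoothNear U x → SmoothNear V x →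
      mlieBracket 𝓘(ℝ, E) U (mlieBracket 𝓘(ℝ, E) V (f • W)) x =
      mvfderiv 𝓘(ℝ, E) (fun y ↦ mvfderiv 𝓘(ℝ, E) f y (V y)) x (U x) • W x
      + mvfderiv 𝓘(ℝ, E) f x (V x) • mlieBracket 𝓘(ℝ, E) U W x
      + (mvfderiv 𝓘(ℝ, E) f x (U x) • mlieBracket 𝓘(ℝ, E) V W x
      + f x • mlieBracket 𝓘(ℝ, E) U (mlieBracket 𝓘(ℝ, E) V W) x) := by
    intro U V hU hV
    have hVW := hV.mlieBracket hW
    have hVf := hf.mvfderiv hV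
    rw [(Filter.EventuallyEq.refl _ U).mlieBracket_vectorField_eq (key V),
      mlieBracket_add_right (hW.smul hVf).mdifferentiableAt (hVW.smul hf).mdifferentiableAt,
      mlieBracket_smul_right hVf.mdifferentiableAt hW.mdifferentiableAt,
      mlieBracket_smul_right hf.mdifferentiableAt hVW.mdifferentiableAt]
  have h1 := jac (hW.smul hf)
  have h2 := jac hW
  rw [expand hU hV, expand hV hU, mlieBracket_smul_right hf.mdifferentiableAt
    hW.mdifferentiableAt, h2] at h1
  -- All brackets with `W` cancel, the second-order ones by the Jacobi identity for `W` itself; only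
  -- a multiple of `W x ≠ 0` is left.
  have h3 : (mvfderiv 𝓘(ℝ, E) f x (mlieBracket 𝓘(ℝ, E) U V x) -
      (mvfderiv 𝓘(ℝ, E) (fun y ↦ mvfderiv 𝓘(ℝ, E) f y (V y)) x (U x) -
      mvfderiv 𝓘(ℝ, E) (fun y ↦ mvfderiv 𝓘(ℝ, E) f y (U y)) x (V x))) • W x
      = 0 := by
    rw [← sub_eq_zero] at h1
    rw [← neg_eq_zero, ← h1]
    module
  rcases smul_eq_zero.1 h3 with h | h
  · exact sub_eq_zero.1 h
  · exact absurd h hWx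

end Inner

/-! ### Traces over a subspace in different orthonormal systems. -/

section LinearAlgebra

variable {V : Type*} [NormedAddCommGroup V] [InnerProductSpace ℝ V] {κ ι : Type*} [Fintype κ]
  [Fintype ι] {S : Submodule ℝ V} {Z : κ → V}

lemma starProjection_eq_sum_of_orthonormal [S.HasOrthogonalProjection] (hZ : Orthonormal ℝ Z)
    (hS : Submodule.span ℝ (Set.range Z) = S) (u : V) :
    S.starProjection u = ∑ a, (inner ℝ (Z a) u : ℝ) • Z a := by
  classical
  have hmem : ∀ a, Z a ∈ S := fun a ↦ hS ▸ Submodule.subset_span ⟨a, rfl⟩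
  apply Submodule.eq_starProjection_of_mem_orthogonal
  · exact Submodule.sum_mem _ fun a _ ↦ S.smul_mem _ (hmem a)
  · rw [← hS, Submodule.mem_orthogonal']
    intro v hv
    induction hv using Submodule.span_induction with
    | mem v hv =>
      obtain ⟨b, rfl⟩ := hv
      simp [inner_sub_left, sum_inner, inner_smul_left, orthonormal_iff_ite.1 hZ,
        real_inner_comm]
    | zero => simp
    | add v w _ _ hv hw => rw [inner_add_right, hv, hw, add_zero]
    | smul c v _ hv => rw [inner_smul_right, hv, mul_zero]

/-- The coefficient matrix has orthonormal rows, so it preserves traces even when it is not square.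
Parseval's identity supplies `hc` in both applications below. -/
lemma sum_bilin_eq_of_coeff (B : V →ₗ[ℝ] V →ₗ[ℝ] ℝ) {v : ι → V} {c : κ → ι → ℝ}
    [DecidableEq κ] (hv : ∀ i, v i = ∑ a, c a i • Z a)
    (hc : ∀ a b, ∑ i, c a i * c b i = if a = b then 1 else 0) :
    ∑ i, B (v i) (v i) = ∑ a, B (Z a) (Z a) := by
  have h : ∀ i, B (v i) (v i) = ∑ a, ∑ b, c a i * c b i * B (Z a) (Z b) := by
    intro i
    simp only [hv i, map_sum, LinearMap.sum_apply, map_smul, LinearMap.smul_apply, smul_eq_mul,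
      Finset.mul_sum]
    rw [Finset.sum_comm]
    refine Finset.sum_congr rfl fun a _ ↦ Finset.sum_congr rfl fun b _ ↦ by ring
  simp only [h]
  rw [Finset.sum_comm]
  refine Finset.sum_congr rfl fun a _ ↦ ?_
  rw [Finset.sum_comm]
  simp only [← Finset.sum_mul, hc]
  simp

lemma sum_bilin_orthonormalBasis_submodule [S.HasOrthogonalProjection] (hZ : Orthonormal ℝ Z)
    (hS : Submodule.span ℝ (Set.range Z) = S) (b : OrthonormalBasis ι ℝ S)
    (B : V →ₗ[ℝ] V →ₗ[ℝ] ℝ) :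
    ∑ i, B (b i) (b i) = ∑ a, B (Z a) (Z a) := by
  classical
  have hmem : ∀ a, Z a ∈ S := fun a ↦ hS ▸ Submodule.subset_span ⟨a, rfl⟩
  refine sum_bilin_eq_of_coeff B (c := fun a i ↦ inner ℝ (Z a) (b i : V)) (fun i ↦ ?_) fun a c ↦ ?_
  · rw [← starProjection_eq_sum_of_orthonormal hZ hS, Submodule.starProjection_eq_self_iff.2]
    exact (b i).2
  · have := b.sum_inner_mul_inner ⟨Z a, hmem a⟩ ⟨Z c, hmem c⟩
    simp only [Submodule.coe_inner] at this
    rw [orthonormal_iff_ite.1 hZ] at this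
    rw [← this]
    exact Finset.sum_congr rfl fun i _ ↦ by rw [real_inner_comm (Z c)]

lemma sum_bilin_starProjection [S.HasOrthogonalProjection] (hZ : Orthonormal ℝ Z)
    (hS : Submodule.span ℝ (Set.range Z) = S) (b : OrthonormalBasis ι ℝ V)
    (B : V →ₗ[ℝ] V →ₗ[ℝ] ℝ) :
    ∑ i, B (S.starProjection (b i)) (S.starProjection (b i)) = ∑ a, B (Z a) (Z a) := by
  classical
  refine sum_bilin_eq_of_coeff B (c := fun a i ↦ inner ℝ (Z a) (b i))
    (fun i ↦ starProjection_eq_sum_of_orthonormal hZ hS _) fun a c ↦ ?_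
  have := b.sum_inner_mul_inner (Z a) (Z c)
  rw [orthonormal_iff_ite.1 hZ] at this
  rw [← this]
  exact Finset.sum_congr rfl fun i _ ↦ by rw [real_inner_comm (Z c)]

end LinearAlgebra

/-! ### Smooth vertical orthonormal frames and the vertical gradient. -/

section Frame

variable {E : Type*} [NormedAddCommGroup E] [NormedSpace ℝ E] [FiniteDimensional ℝ E]
  {M : Type*} [TopologicalSpace M] [ChartedSpace E M] [IsManifold 𝓘(ℝ, E) ∞ M]
  [RiemannianBundle (fun x : M ↦ TangentSpace 𝓘(ℝ, E) x)]
  [IsContMDiffRiemannianBundle 𝓘(ℝ, E) ∞ E (fun x : M ↦ TangentSpace 𝓘(ℝ, E) x)]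
  {m n : ℕ} {x : M} {Z : Fin m → Π x : M, TangentSpace 𝓘(ℝ, E) x}

/-- The recursion is rational in inner products of earlier fields. Its denominators are nonzero at
`x` by independence there, hence near `x` by continuity. -/
lemma smoothNear_gramSchmidt (hZ : ∀ a, SmoothNear (Z a) x)
    (hli : LinearIndependent ℝ fun a ↦ Z a x) (a : Fin m) :
    SmoothNear (fun y ↦ InnerProductSpace.gramSchmidt ℝ (fun b ↦ Z b y) a) x := by
  induction a using WellFoundedLT.induction with
  | ind a ih =>
  have heq : (fun y ↦ InnerProductSpace.gramSchmidt ℝ (fun b ↦ Z b y) a) = Z a -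
      fun y ↦ ∑ i ∈ Finset.Iio a,
      ((fun y ↦ inner ℝ (InnerProductSpace.gramSchmidt ℝ (fun b ↦ Z b y) i) (Z a y) /
        inner ℝ (InnerProductSpace.gramSchmidt ℝ (fun b ↦ Z b y) i)
          (InnerProductSpace.gramSchmidt ℝ (fun b ↦ Z b y) i)) •
        fun y ↦ InnerProductSpace.gramSchmidt ℝ (fun b ↦ Z b y) i) y := by
    ext1 y
    simp only [Pi.sub_apply, Pi.smul_apply', real_inner_self_eq_norm_sq]
    rw [eq_sub_iff_add_eq]
    exact (InnerProductSpace.gramSchmidt_def'' ℝ (fun b ↦ Z b y) a).symm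
  rw [heq]
  refine (hZ a).sub (SmoothNear.sum _ fun i hi ↦ SmoothNear.smul ?_ (ih i (Finset.mem_Iio.1 hi)))
  have hi := ih i (Finset.mem_Iio.1 hi)
  have h0 : ∀ᶠ y in 𝓝 x, inner ℝ (InnerProductSpace.gramSchmidt ℝ (fun b ↦ Z b y) i)
      (InnerProductSpace.gramSchmidt ℝ (fun b ↦ Z b y) i) ≠ 0 :=
    (hi.inner hi).self_of_nhds.continuousAt.eventually_ne
      (by simpa using InnerProductSpace.gramSchmidt_ne_zero i hli)
  filter_upwards [hi.inner (hZ a), hi.inner hi, h0] with y h1 h2 h0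
  exact h1.div₀ h2 h0

lemma smoothNear_gramSchmidtNormed (hZ : ∀ a, SmoothNear (Z a) x)
    (hli : LinearIndependent ℝ fun a ↦ Z a x) (a : Fin m) :
    SmoothNear (fun y ↦ InnerProductSpace.gramSchmidtNormed ℝ (fun b ↦ Z b y) a) x := by
  have hg := smoothNear_gramSchmidt hZ hli a
  set G : Π x : M, TangentSpace 𝓘(ℝ, E) x :=
    fun y ↦ InnerProductSpace.gramSchmidt ℝ (fun b ↦ Z b y) a with hG
  have heq : (fun y ↦ InnerProductSpace.gramSchmidtNormed ℝ (fun b ↦ Z b y) a) =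
      (fun y ↦ (√(inner ℝ (G y) (G y)))⁻¹) • G := by
    ext1 y
    simp only [Pi.smul_apply', ← norm_eq_sqrt_real_inner]
    rfl
  rw [heq]
  refine SmoothNear.smul ?_ hg
  have h0 : ∀ᶠ y in 𝓝 x, inner ℝ (G y) (G y) ≠ 0 :=
    (hg.inner hg).self_of_nhds.continuousAt.eventually_ne
      (by simpa using InnerProductSpace.gramSchmidt_ne_zero a hli)
  filter_upwards [hg.inner hg, h0] with y h1 h0
  have hsq : CMDiffAt ∞ (fun y ↦ √(inner ℝ (G y) (G y))) y :=
    (Real.contDiffAt_sqrt h0).contMDiffAt.comp y h1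
  refine hsq.inv₀ ?_
  rw [← norm_eq_sqrt_real_inner]
  simpa using h0

/-- A local orthonormal frame of the vertical bundle which is smooth near `x`. -/
structure Foliation.IsOrthonormalFrameNear (F : Foliation E M n m)
    (Z : Fin m → Π x : M, TangentSpace 𝓘(ℝ, E) x) (x : M) : Prop where
  smoothNear : ∀ a, SmoothNear (Z a) x
  orthonormal : ∀ᶠ y in 𝓝 x, Orthonormal ℝ fun a ↦ Z a y
  span_eq : ∀ᶠ y in 𝓝 x, Submodule.span ℝ (Set.range fun a ↦ Z a y) = F.vert y

lemma Foliation.exists_isOrthonormalFrameNear (F : Foliation E M n m) (x : M) :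
    ∃ Z, F.IsOrthonormalFrameNear Z x := by
  obtain ⟨U, hU, hxU, Z, hZ, hZU⟩ := F.exists_frame x
  have hUx := hU.mem_nhds hxU
  refine ⟨fun a y ↦ InnerProductSpace.gramSchmidtNormed ℝ (fun b ↦ Z b y) a, fun a ↦ ?_, ?_, ?_⟩
  · refine smoothNear_gramSchmidtNormed (fun a ↦ ?_) (hZU x hxU).1 a
    filter_upwards [hUx] with y hy using (hZ a).contMDiffAt (hU.mem_nhds hy)
  · filter_upwards [hUx] with y hy
    exact InnerProductSpace.gramSchmidtNormed_orthonormal (hZU y hy).1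
  · filter_upwards [hUx] with y hy
    rw [← (hZU y hy).2]
    exact (InnerProductSpace.span_gramSchmidtNormed_range _).trans
      (InnerProductSpace.span_gramSchmidt ℝ _)

lemma Foliation.IsOrthonormalFrameNear.eventually_mem {F : Foliation E M n m}
    (h : F.IsOrthonormalFrameNear Z x) (a : Fin m) : ∀ᶠ y in 𝓝 x, Z a y ∈ F.vert y := by
  filter_upwards [h.span_eq] with y hy
  exact hy ▸ Submodule.subset_span ⟨a, rfl⟩

lemma inner_gradient (f : M → ℝ) (x : M) (u : TangentSpace 𝓘(ℝ, E) x) :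
    inner ℝ (gradient f x) u = mvfderiv 𝓘(ℝ, E) f x u := by
  simp [gradient]

variable (F : Foliation E M n m) (f : M → ℝ)

lemma Foliation.vertGrad_mem (x : M) : F.vertGrad f x ∈ F.vert x :=
  Submodule.starProjection_apply_mem _ _

lemma Foliation.inner_vertGrad {u : TangentSpace 𝓘(ℝ, E) x} (hu : u ∈ F.vert x) :
    inner ℝ (F.vertGrad f x) u = mvfderiv 𝓘(ℝ, E) f x u := by
  rw [← inner_gradient, Foliation.vertGrad, Foliation.vertPart,
    Submodule.inner_starProjection_left_eq_right, Submodule.starProjection_eq_self_iff.2 hu]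

/-- In a smooth orthonormal frame the vertical gradient is `∑ (Z_a f) Z_a`. -/
lemma Foliation.smoothNear_vertGrad {f : M → ℝ} (hf : SmoothFunNear (E := E) f x) :
    SmoothNear (F.vertGrad f) x := by
  obtain ⟨Z, hZ⟩ := F.exists_isOrthonormalFrameNear x
  refine (SmoothNear.sum Finset.univ fun a _ ↦
    (hZ.smoothNear a).smul (hf.mvfderiv (hZ.smoothNear a))).congr ?_
  filter_upwards [hZ.orthonormal, hZ.span_eq] with y h1 h2
  have h3 : F.vertGrad f y = ∑ a, (inner ℝ (Z a y) (gradient f y) : ℝ) • Z a y :=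
    starProjection_eq_sum_of_orthonormal h1 h2 _
  rw [h3]
  refine Finset.sum_congr rfl fun a _ ↦ ?_
  rw [real_inner_comm, inner_gradient]
  rfl

lemma Foliation.gamma_eq (f g : M → ℝ) (x : M) :
    F.gamma f g x = mvfderiv 𝓘(ℝ, E) g x (F.vertGrad f x) := by
  rw [← F.inner_vertGrad g (F.vertGrad_mem f x), real_inner_comm]
  rfl

end Frame

section Connection

variable {E : Type*} [NormedAddCommGroup E] [NormedSpace ℝ E] [FiniteDimensional ℝ E]
  {M : Type*} [TopologicalSpace M] [ChartedSpace E M] [IsManifold 𝓘(ℝ, E) ∞ M]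

/-! ### Tensorial operations depend only on values at the point. -/

section Tensoriality

/-- An operation on vector fields is tensorial at `x` with respect to smooth fields if it is
additive and linear over functions, for fields and functions that are smooth near `x`. -/
structure SmoothTensorialAt {A : Type*} [AddCommGroup A] [Module ℝ A]
    (Φ : (Π x : M, TangentSpace 𝓘(ℝ, E) x) → A) (x : M) : Prop where
  smul : ∀ {f : M → ℝ} {V : Π x : M, TangentSpace 𝓘(ℝ, E) x},
    SmoothFunNear (E := E) f x → SmoothNear V x → Φ (f • V) = f x • Φ V
  add : ∀ {V W : Π x : M, TangentSpace 𝓘(ℝ, E) x},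
    SmoothNear V x → SmoothNear W x → Φ (V + W) = Φ V + Φ W

namespace SmoothTensorialAt

variable {A : Type*} [AddCommGroup A] [Module ℝ A]
  {Φ : (Π x : M, TangentSpace 𝓘(ℝ, E) x) → A} {x : M} {V W : Π x : M, TangentSpace 𝓘(ℝ, E) x}

/-- The indicator `ψ` of the set where the fields agree is locally constant near `x`, hence smooth
there, and `ψ W = ψ V` holds globally. -/
lemma congr_of_eventuallyEq (hΦ : SmoothTensorialAt Φ x) (hV : SmoothNear V x)
    (h : W =ᶠ[𝓝 x] V) : Φ W = Φ V := by
  classical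
  have hW : SmoothNear W x := hV.congr h
  let ψ (y : M) : ℝ := if W y = V y then 1 else 0
  have hψx : ψ x = 1 := by simp [ψ, h.self_of_nhds]
  have hψ : SmoothFunNear (E := E) ψ x := by
    filter_upwards [h.eventuallyEq_nhds] with y hy
    have : CMDiffAt ∞ (fun _ : M ↦ (1 : ℝ)) y := contMDiffAt_const
    exact this.congr_of_eventuallyEq (hy.mono fun z hz ↦ by simp [ψ, hz])
  have heq : ψ • W = ψ • V := by
    ext1 y
    by_cases hy : W y = V y <;> simp [ψ, hy]
  have h1 := hΦ.smul hψ hW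
  have h2 := hΦ.smul hψ hV
  rw [hψx, one_smul] at h1 h2
  rw [← h1, ← h2, heq]

lemma zero (hΦ : SmoothTensorialAt Φ x) : Φ 0 = 0 := by
  have h0 : SmoothNear (0 : Π x : M, TangentSpace 𝓘(ℝ, E) x) x :=
    Filter.Eventually.of_forall fun y ↦ contMDiff_zeroSection ℝ _ y
  simpa using hΦ.add h0 h0

lemma sum (hΦ : SmoothTensorialAt Φ x) {ι : Type*} (s : Finset ι)
    {Z : ι → Π x : M, TangentSpace 𝓘(ℝ, E) x} (hZ : ∀ i ∈ s, SmoothNear (Z i) x) :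
    Φ (fun y ↦ ∑ i ∈ s, Z i y) = ∑ i ∈ s, Φ (Z i) := by
  classical
  induction s using Finset.induction_on with
  | empty =>
      simp only [Finset.sum_empty]
      exact hΦ.zero
  | insert a s ha h =>
      simp only [Finset.mem_insert, forall_eq_or_imp] at hZ
      simp only [Finset.sum_insert ha, ← h hZ.2]
      exact hΦ.add hZ.1 (.sum _ hZ.2)

/-- In a local frame `s i`, tensoriality turns `Φ V` into a combination of the `Φ (s i)` whose
coefficients are those of `V x`. -/
lemma pointwise (hΦ : SmoothTensorialAt Φ x) (hV : SmoothNear V x) (hW : SmoothNear W x)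
    (h : V x = W x) : Φ V = Φ W := by
  let t := trivializationAt E (TangentSpace 𝓘(ℝ, E) : M → Type _) x
  have hx : x ∈ t.baseSet := FiberBundle.mem_baseSet_trivializationAt E _ x
  have hnear : ∀ᶠ y in 𝓝 x, y ∈ t.baseSet := t.open_baseSet.mem_nhds hx
  let b := Module.Basis.ofVectorSpace ℝ E
  let s := t.localFrame b
  let c := t.localFrameCoeff 𝓘(ℝ, E) b
  have hs (i) : SmoothNear (s i) x := by
    filter_upwards [hnear] with y hy using contMDiffAt_localFrame_of_mem ∞ _ b i hy
  have hc {V : Π x : M, TangentSpace 𝓘(ℝ, E) x} (hV : SmoothNear V x) (i) :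
      SmoothFunNear (E := E) (LinearMap.piApply (c i) V) x := by
    filter_upwards [hnear, hV] with y hy hVy using contMDiffAt_localFrameCoeff b hy hVy i
  have hΦ_eq {V : Π x : M, TangentSpace 𝓘(ℝ, E) x} (hV : SmoothNear V x) :
      Φ V = ∑ i, c i x (V x) • Φ (s i) := by
    have hsm := fun i ↦ (hs i).smul (hc hV i)
    rw [hΦ.congr_of_eventuallyEq (SmoothNear.sum Finset.univ fun i _ ↦ hsm i)
      (t.eventually_eq_localFrame_sum_coeff_smul b hx), hΦ.sum _ fun i _ ↦ hsm i]
    exact Finset.sum_congr rfl fun i _ ↦ hΦ.smul (hc hV i) (hs i)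
  rw [hΦ_eq hV, hΦ_eq hW, h]

end SmoothTensorialAt

end Tensoriality

/-! ### The connection on germs of fields, and tensoriality of its curvature. -/

variable [RiemannianBundle (fun x : M ↦ TangentSpace 𝓘(ℝ, E) x)]
  {n m : ℕ} {F : Foliation E M n m}
  {cov : CovariantDerivative 𝓘(ℝ, E) E (TangentSpace 𝓘(ℝ, E) : M → Type _)}
  {f : M → ℝ} {U V W X : Π x : M, TangentSpace 𝓘(ℝ, E) x} {x : M}

lemma curvature_swap : curvature cov U V W x = - curvature cov V U W x := by
  simp only [curvature]
  rw [mlieBracket_swap_apply, map_neg]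
  module

lemma SmoothNear.cov_congr (hV : SmoothNear V x) (h : W =ᶠ[𝓝 x] V) : cov W x = cov V x :=
  cov.isCovariantDerivativeOnUniv.congr_of_eventuallyEq (hV.congr h).mdifferentiableAt
    hV.mdifferentiableAt univ_mem h

lemma SmoothNear.cov_add (hV : SmoothNear V x) (hW : SmoothNear W x) :
    cov (V + W) x = cov V x + cov W x :=
  cov.isCovariantDerivativeOnUniv.add hV.mdifferentiableAt hW.mdifferentiableAt

lemma SmoothNear.cov_smul (hV : SmoothNear V x) (hf : SmoothFunNear (E := E) f x)
    (u : TangentSpace 𝓘(ℝ, E) x) :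
    cov (f • V) x u = f x • cov V x u + mvfderiv 𝓘(ℝ, E) f x u • V x := by
  rw [cov.isCovariantDerivativeOnUniv.leibniz hV.mdifferentiableAt hf.mdifferentiableAt]
  simp

namespace Foliation.IsHladkyConnection

variable (hcov : F.IsHladkyConnection cov)
include hcov

lemma smoothNear (hU : SmoothNear U x) (hW : SmoothNear W x) :
    SmoothNear (fun y ↦ cov W y (U y)) x := by
  obtain ⟨O, hO, hOo, hxO⟩ := eventually_nhds_iff.1 (hU.and hW)
  filter_upwards [hOo.mem_nhds hxO] with y hy
  exact (hcov.smooth O hOo U W (fun z hz ↦ (hO z hz).1.contMDiffWithinAt)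
    fun z hz ↦ (hO z hz).2.contMDiffWithinAt).contMDiffAt (hOo.mem_nhds hy)

lemma mvfderiv_inner (hV : SmoothNear V x) (hW : SmoothNear W x) (u : TangentSpace 𝓘(ℝ, E) x) :
    mvfderiv 𝓘(ℝ, E) (fun y ↦ inner ℝ (V y) (W y)) x u
      = inner ℝ (cov V x u) (W x) + inner ℝ (V x) (cov W x u) := by
  obtain ⟨O, hO, hOo, hxO⟩ := eventually_nhds_iff.1 (hV.and hW)
  exact hcov.metric O hOo V W (fun z hz ↦ (hO z hz).1.contMDiffWithinAt)
    (fun z hz ↦ (hO z hz).2.contMDiffWithinAt) x hxO u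

lemma cov_mem_vert (hW : SmoothNear W x) (hWv : ∀ᶠ y in 𝓝 x, W y ∈ F.vert y)
    (u : TangentSpace 𝓘(ℝ, E) x) : cov W x u ∈ F.vert x := by
  obtain ⟨O, hO, hOo, hxO⟩ := eventually_nhds_iff.1 (hW.and hWv)
  exact hcov.parallel_vert O hOo W (fun z hz ↦ (hO z hz).1.contMDiffWithinAt)
    (fun z hz ↦ (hO z hz).2) x hxO u

/-- The torsion is a tensor, so it is enough that the fields are vertical at `x` itself. -/
lemma mlieBracket_eq (hU : SmoothNear U x) (hV : SmoothNear V x) (hUv : U x ∈ F.vert x)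
    (hVv : V x ∈ F.vert x) :
    mlieBracket 𝓘(ℝ, E) U V x = cov V x (U x) - cov U x (V x) := by
  have h := cov.torsion_apply hU.mdifferentiableAt hV.mdifferentiableAt
  rw [hcov.torsion_vert x _ hUv _ hVv] at h
  exact (sub_eq_zero.1 h.symm).symm

lemma curvature_mem_vert (hU : SmoothNear U x) (hV : SmoothNear V x) (hW : SmoothNear W x)
    (hWv : ∀ᶠ y in 𝓝 x, W y ∈ F.vert y) : curvature cov U V W x ∈ F.vert x := by
  have h : ∀ {U : Π x : M, TangentSpace 𝓘(ℝ, E) x},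
      ∀ᶠ y in 𝓝 x, cov W y (U y) ∈ F.vert y := by
    intro U
    filter_upwards [hW.eventually, hWv.eventually_nhds] with y h1 h2
    exact hcov.cov_mem_vert h1 h2 _
  exact Submodule.sub_mem _ (Submodule.sub_mem _
    (hcov.cov_mem_vert (hcov.smoothNear hV hW) h _)
    (hcov.cov_mem_vert (hcov.smoothNear hU hW) h _)) (hcov.cov_mem_vert hW hWv _)

/-- The Leibniz term of `∇_V (f ∇_U W)` cancels the one from `[fU, V] = f [U, V] - (Vf) U`. -/
lemma smoothTensorialAt_curvature_left (hW : SmoothNear W x) :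
    SmoothTensorialAt (fun U ↦ curvature cov U V W x) x where
  smul {f U} hf hU := by
    have h := (hcov.smoothNear hU hW).cov_smul (cov := cov) hf (V x)
    have h' : (fun y ↦ cov W y ((f • U) y)) = f • fun y ↦ cov W y (U y) := by
      ext1 y
      simp
    simp only [curvature]
    rw [h', h, mlieBracket_smul_left hf.mdifferentiableAt hU.mdifferentiableAt]
    simp only [Pi.smul_apply', map_smul, map_add, neg_smul, map_neg]
    module
  add {U U'} hU hU' := by
    have h := (hcov.smoothNear hU hW).cov_add (cov := cov) (hcov.smoothNear hU' hW)
    have h' : (fun y ↦ cov W y ((U + U') y)) =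
        (fun y ↦ cov W y (U y)) + fun y ↦ cov W y (U' y) := by
      ext1 y
      simp
    simp only [curvature]
    rw [h', h, mlieBracket_add_left hU.mdifferentiableAt hU'.mdifferentiableAt]
    simp only [Pi.add_apply, map_add, add_apply]
    module

lemma smoothTensorialAt_curvature_middle (hW : SmoothNear W x) :
    SmoothTensorialAt (fun V ↦ curvature cov U V W x) x where
  smul {f V} hf hV := by
    have := (hcov.smoothTensorialAt_curvature_left (V := U) hW).smul hf hV
    simp only [curvature_swap (U := U), this, smul_neg]
  add {V V'} hV hV' := by
    have := (hcov.smoothTensorialAt_curvature_left (V := U) hW).add hV hV'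
    simp only [curvature_swap (U := U), this, neg_add]

end Foliation.IsHladkyConnection

variable [IsContMDiffRiemannianBundle 𝓘(ℝ, E) ∞ E (fun x : M ↦ TangentSpace 𝓘(ℝ, E) x)]

namespace Foliation.IsHladkyConnection

variable (hcov : F.IsHladkyConnection cov)
include hcov

/-- Mixed first-order terms cancel in pairs; the coefficient of `W` is `U(Vf) - V(Uf) - [U, V]f =
0`. -/
lemma smoothTensorialAt_curvature_right (hU : SmoothNear U x) (hV : SmoothNear V x) :
    SmoothTensorialAt (fun W ↦ curvature cov U V W x) x where
  smul {f W} hf hW := by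
    have h : ∀ {U : Π x : M, TangentSpace 𝓘(ℝ, E) x}, (fun y ↦ cov (f • W) y (U y)) =ᶠ[𝓝 x]
        f • (fun y ↦ cov W y (U y)) + (fun y ↦ mvfderiv 𝓘(ℝ, E) f y (U y)) • W := by
      intro U
      filter_upwards [hf.eventually_nhds, hW.eventually] with y h1 h2
      exact h2.cov_smul h1 _
    have h2 : ∀ {U : Π x : M, TangentSpace 𝓘(ℝ, E) x}, SmoothNear U x →
        ∀ v, cov (fun y ↦ cov (f • W) y (U y)) x v =
        f x • cov (fun y ↦ cov W y (U y)) x v + mvfderiv 𝓘(ℝ, E) f x v • cov W x (U x) +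
        (mvfderiv 𝓘(ℝ, E) f x (U x) • cov W x v +
        mvfderiv 𝓘(ℝ, E) (fun y ↦ mvfderiv 𝓘(ℝ, E) f y (U y)) x v • W x) := by
      intro U hU v
      have hUW := hcov.smoothNear hU hW
      have hfU := hf.mvfderiv hU
      rw [((hUW.smul hf).add (hW.smul hfU)).cov_congr h,
        (hUW.smul hf).cov_add (hW.smul hfU), add_apply, hUW.cov_smul hf,
        hW.cov_smul hfU]
    simp only [curvature, h2 hU, h2 hV, hW.cov_smul hf, mvfderiv_mlieBracket hf hU hV]
    module
  add {W W'} hW hW' := by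
    have h : ∀ {U : Π x : M, TangentSpace 𝓘(ℝ, E) x}, (fun y ↦ cov (W + W') y (U y)) =ᶠ[𝓝 x]
        (fun y ↦ cov W y (U y)) + (fun y ↦ cov W' y (U y)) := by
      intro U
      filter_upwards [hW.eventually, hW'.eventually] with y h1 h2
      rw [h1.cov_add h2]
      rfl
    have h2 : ∀ {U : Π x : M, TangentSpace 𝓘(ℝ, E) x}, SmoothNear U x →
        cov (fun y ↦ cov (W + W') y (U y)) x =
        cov (fun y ↦ cov W y (U y)) x + cov (fun y ↦ cov W' y (U y)) x := by
      intro U hU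
      have h1 := hcov.smoothNear hU hW
      have h2 := hcov.smoothNear hU hW'
      rw [(h1.add h2).cov_congr h, h1.cov_add h2]
    simp only [curvature, h2 hU, h2 hV, hW.cov_add hW', add_apply]
    module

/-- This frees `ricci` from the extensions chosen in its definition. -/
lemma curvature_congr {U' V' W' : Π x : M, TangentSpace 𝓘(ℝ, E) x} (hU : SmoothNear U x)
    (hU' : SmoothNear U' x) (hV : SmoothNear V x) (hV' : SmoothNear V' x) (hW : SmoothNear W x)
    (hW' : SmoothNear W' x) (hUU : U x = U' x) (hVV : V x = V' x) (hWW : W x = W' x) :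
    curvature cov U V W x = curvature cov U' V' W' x :=
  ((hcov.smoothTensorialAt_curvature_left hW).pointwise hU hU' hUU).trans <|
    ((hcov.smoothTensorialAt_curvature_middle hW).pointwise hV hV' hVV).trans
    ((hcov.smoothTensorialAt_curvature_right hU' hV').pointwise hW hW' hWW)

end Foliation.IsHladkyConnection

end Connection

/-! ### The algebra of the Bochner formula. -/

section LinearAlgebra

variable {V : Type*} [NormedAddCommGroup V] [InnerProductSpace ℝ V] {κ ι : Type*} [Fintype κ]
  [Fintype ι] {S : Submodule ℝ V} {Z : κ → V}

lemma eq_sum_of_orthonormal_of_mem [S.HasOrthogonalProjection] (hZ : Orthonormal ℝ Z)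
    (hS : Submodule.span ℝ (Set.range Z) = S) {u : V} (hu : u ∈ S) :
    u = ∑ a, (inner ℝ (Z a) u : ℝ) • Z a := by
  rw [← starProjection_eq_sum_of_orthonormal hZ hS, Submodule.starProjection_eq_self_iff.2 hu]

/-- An endomorphism with range in `S` has the same trace as its restriction to `S`; applied to `w ↦
R(w, X)X`. -/
lemma sum_inner_orthonormalBasis_of_range_le [S.HasOrthogonalProjection] (hZ : Orthonormal ℝ Z)
    (hS : Submodule.span ℝ (Set.range Z) = S) (b : OrthonormalBasis ι ℝ V)
    (L : V →ₗ[ℝ] V) (hL : ∀ u, L u ∈ S) :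
    ∑ i, inner ℝ (L (b i)) (b i) = ∑ a, (inner ℝ (L (Z a)) (Z a) : ℝ) := by
  have h : ∀ i, inner ℝ (L (b i)) (b i) =
      ∑ a, (inner ℝ (Z a) (L (b i)) * inner ℝ (Z a) (b i) : ℝ) := by
    intro i
    conv_lhs => rw [eq_sum_of_orthonormal_of_mem hZ hS (hL (b i))]
    simp [sum_inner, inner_smul_left]
  simp only [h]
  rw [Finset.sum_comm]
  refine Finset.sum_congr rfl fun a _ ↦ ?_
  have hLZ : L (Z a) = ∑ i, (inner ℝ (b i) (Z a) : ℝ) • L (b i) := by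
    conv_lhs => rw [← b.sum_repr' (Z a)]
    simp
  rw [hLZ, sum_inner]
  refine Finset.sum_congr rfl fun i _ ↦ ?_
  rw [real_inner_smul_left, real_inner_comm (Z a) (L (b i)), real_inner_comm (Z a) (b i), mul_comm]

/-- The algebraic identity behind the Bochner formula: an antisymmetric perturbation of the frame
does not contribute when the form `⟨A ·, ·⟩` is symmetric. -/
lemma sum_inner_sub_eq_sum_sq [S.HasOrthogonalProjection] (hZ : Orthonormal ℝ Z)
    (hS : Submodule.span ℝ (Set.range Z) = S) (A : V →ₗ[ℝ] V) (hA : ∀ u, A u ∈ S)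
    (hsymm : ∀ a b, inner ℝ (A (Z a)) (Z b) = inner ℝ (A (Z b)) (Z a))
    {D : κ → V} (hD : ∀ a, D a ∈ S)
    (hanti : ∀ a b, inner ℝ (D a) (Z b) = -inner ℝ (D b) (Z a)) :
    ∑ a, (inner ℝ (A (A (Z a) - D a)) (Z a) - inner ℝ (A (Z a)) (D a)) =
      ∑ a, ∑ b, (inner ℝ (A (Z a)) (Z b) : ℝ) ^ 2 := by
  have h : ∀ u ∈ S, ∀ a, inner ℝ (A u) (Z a) =
      ∑ b, (inner ℝ (Z b) u * inner ℝ (A (Z b)) (Z a) : ℝ) := by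
    intro u hu a
    conv_lhs => rw [eq_sum_of_orthonormal_of_mem hZ hS hu]
    simp [sum_inner, inner_smul_left]
  have h2 : ∀ a, (inner ℝ (A (Z a)) (D a) : ℝ) =
      ∑ b, (inner ℝ (A (Z a)) (Z b) * inner ℝ (D a) (Z b) : ℝ) := by
    intro a
    conv_lhs => rw [eq_sum_of_orthonormal_of_mem hZ hS (hD a)]
    simp only [inner_sum, inner_smul_right]
    exact Finset.sum_congr rfl fun b _ ↦ by rw [real_inner_comm (D a), mul_comm]
  -- Contraction of a symmetric with an antisymmetric matrix: exchanging the indices changes the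
  -- sign.
  have h3 : ∑ a, ∑ b, (inner ℝ (A (Z a)) (Z b) * inner ℝ (D a) (Z b) : ℝ) = 0 := by
    have : ∑ a, ∑ b, (inner ℝ (A (Z a)) (Z b) * inner ℝ (D a) (Z b) : ℝ) =
        -∑ a, ∑ b, (inner ℝ (A (Z a)) (Z b) * inner ℝ (D a) (Z b) : ℝ) := by
      conv_lhs => rw [Finset.sum_comm]
      simp only [← Finset.sum_neg_distrib]
      refine Finset.sum_congr rfl fun a _ ↦ Finset.sum_congr rfl fun b _ ↦ ?_
      rw [hsymm b a, hanti b a]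
      ring
    linarith
  simp only [map_sub, inner_sub_left, h _ (hA _), h _ (hD _), h2, Finset.sum_sub_distrib, h3]
  have h4 : ∑ a, ∑ b, (inner ℝ (Z b) (D a) * inner ℝ (A (Z b)) (Z a) : ℝ) = 0 := by
    rw [← h3]
    refine Finset.sum_congr rfl fun a _ ↦ Finset.sum_congr rfl fun b _ ↦ ?_
    rw [hsymm b a, real_inner_comm, mul_comm]
  rw [h4, sub_zero, sub_zero]
  refine Finset.sum_congr rfl fun a _ ↦ Finset.sum_congr rfl fun b _ ↦ ?_
  rw [hsymm b a, real_inner_comm, sq]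

/-- In each index separately, the square is the diagonal of a product of two equal linear
functionals, so the trace comparison applies twice. -/
lemma sum_sq_inner_starProjection [S.HasOrthogonalProjection] (hZ : Orthonormal ℝ Z)
    (hS : Submodule.span ℝ (Set.range Z) = S) (b : OrthonormalBasis ι ℝ V) (A : V →ₗ[ℝ] V) :
    ∑ i, ∑ j, (inner ℝ (A (S.starProjection (b i))) (S.starProjection (b j)) : ℝ) ^ 2 =
      ∑ a, ∑ c, (inner ℝ (A (Z a)) (Z c) : ℝ) ^ 2 := by
  have h1 : ∀ u, ∑ j, (inner ℝ u (S.starProjection (b j)) : ℝ) ^ 2 =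
      ∑ c, (inner ℝ u (Z c) : ℝ) ^ 2 := fun u ↦ by
    simpa [sq] using sum_bilin_starProjection hZ hS b
      ((LinearMap.mul ℝ ℝ).compl₁₂ (innerₗ V u) (innerₗ V u))
  have h2 : ∀ v, ∑ i, (inner ℝ (A (S.starProjection (b i))) v : ℝ) ^ 2 =
      ∑ a, (inner ℝ (A (Z a)) v : ℝ) ^ 2 := fun v ↦ by
    simpa [sq, real_inner_comm] using sum_bilin_starProjection hZ hS b
      ((LinearMap.mul ℝ ℝ).compl₁₂ (innerₗ V v ∘ₗ A) (innerₗ V v ∘ₗ A))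
  simp only [h1]
  rw [Finset.sum_comm]
  simp only [h2]
  rw [Finset.sum_comm]

end LinearAlgebra

/-! ### The leafwise Bochner formula and the drift term. -/

section Bochner

variable {E : Type*} [NormedAddCommGroup E] [NormedSpace ℝ E] [FiniteDimensional ℝ E]
  {M : Type*} [TopologicalSpace M] [ChartedSpace E M]

lemma mvfderiv_congr {f g : M → ℝ} {x : M} (h : f =ᶠ[𝓝 x] g) (u : TangentSpace 𝓘(ℝ, E) x) :
    mvfderiv 𝓘(ℝ, E) f x u = mvfderiv 𝓘(ℝ, E) g x u := by
  simp only [mvfderiv, ContinuousLinearMap.comp_apply, h.mfderiv_eq]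
  rfl

lemma SmoothFunNear.sum {ι : Type*} (s : Finset ι) {f : ι → M → ℝ} {x : M}
    (hf : ∀ i ∈ s, SmoothFunNear (E := E) (f i) x) :
    SmoothFunNear (E := E) (fun y ↦ ∑ i ∈ s, f i y) x := by
  have : ∀ᶠ y in 𝓝 x, ∀ i ∈ s, CMDiffAt ∞ (f i) y := by
    rw [Filter.eventually_all_finset]
    exact hf
  filter_upwards [this] with y hy using contMDiffAt_finsetSum hy

lemma mvfderiv_sum_apply {ι : Type*} (s : Finset ι) {f : ι → M → ℝ} {x : M}
    (hf : ∀ i ∈ s, SmoothFunNear (E := E) (f i) x) (u : TangentSpace 𝓘(ℝ, E) x) :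
    mvfderiv 𝓘(ℝ, E) (fun y ↦ ∑ i ∈ s, f i y) x u = ∑ i ∈ s, mvfderiv 𝓘(ℝ, E) (f i) x u := by
  classical
  induction s using Finset.induction_on with
  | empty => simp [mvfderiv_const]
  | insert a s ha h =>
    simp only [Finset.mem_insert, forall_eq_or_imp] at hf
    simp only [Finset.sum_insert ha, ← h hf.2]
    rw [mvfderiv_fun_add hf.1.mdifferentiableAt (SmoothFunNear.sum s hf.2).mdifferentiableAt]
    rfl

variable [IsManifold 𝓘(ℝ, E) ∞ M]
  [RiemannianBundle (fun x : M ↦ TangentSpace 𝓘(ℝ, E) x)]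
  [IsContMDiffRiemannianBundle 𝓘(ℝ, E) ∞ E (fun x : M ↦ TangentSpace 𝓘(ℝ, E) x)]
  {n m : ℕ} {F : Foliation E M n m}
  {cov : CovariantDerivative 𝓘(ℝ, E) E (TangentSpace 𝓘(ℝ, E) : M → Type _)}
  {f : M → ℝ} {X Y : Π x : M, TangentSpace 𝓘(ℝ, E) x} {x : M}
  {Z : Fin m → Π x : M, TangentSpace 𝓘(ℝ, E) x}

/-- Freezing the coefficients in a vertical frame keeps the extension vertical near `x`, so its
covariant derivatives are vertical too. -/
lemma Foliation.exists_vertical_extension (F : Foliation E M n m) {u : TangentSpace 𝓘(ℝ, E) x}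
    (hu : u ∈ F.vert x) : ∃ U : Π x : M, TangentSpace 𝓘(ℝ, E) x,
      SmoothNear U x ∧ (∀ᶠ y in 𝓝 x, U y ∈ F.vert y) ∧ U x = u := by
  obtain ⟨Z, hZ⟩ := F.exists_isOrthonormalFrameNear x
  refine ⟨fun y ↦ ∑ a, ((fun _ ↦ (inner ℝ (Z a x) u : ℝ)) • Z a) y,
    SmoothNear.sum _ fun a _ ↦ (hZ.smoothNear a).smul
      (Filter.Eventually.of_forall fun y ↦ contMDiffAt_const), ?_,
    (eq_sum_of_orthonormal_of_mem hZ.orthonormal.self_of_nhds hZ.span_eq.self_of_nhds hu).symm⟩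
  filter_upwards [Filter.eventually_all.2 hZ.eventually_mem] with y hy
  exact Submodule.sum_mem _ fun a _ ↦ Submodule.smul_mem _ _ (hy a)

lemma Foliation.vertHessianNormSq_eq_sum {z : Fin m → TangentSpace 𝓘(ℝ, E) x}
    (hz : Orthonormal ℝ z) (hspan : Submodule.span ℝ (Set.range z) = F.vert x) :
    F.vertHessianNormSq cov f x =
      ∑ a, ∑ b, (inner ℝ (cov (F.vertGrad f) x (z a)) (z b) : ℝ) ^ 2 := by
  have h := sum_sq_inner_starProjection hz hspan
    (stdOrthonormalBasis ℝ (TangentSpace 𝓘(ℝ, E) x)) (cov (F.vertGrad f) x : _ →ₗ[ℝ] _)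
  simp only [ContinuousLinearMap.coe_coe] at h
  simp only [Foliation.vertHessianNormSq, Foliation.vertHessian, Foliation.vertPart]
  exact h

namespace Foliation.IsHladkyConnection

variable (hcov : F.IsHladkyConnection cov)
include hcov

/-- The terms `∇_X W` from metricity and from the two brackets cancel. -/
lemma lieDerivMetric_self (hX : SmoothNear X x) (hXv : X x ∈ F.vert x)
    {W : Π x : M, TangentSpace 𝓘(ℝ, E) x} (hW : SmoothNear W x) (hWv : W x ∈ F.vert x) :
    lieDerivMetric X W W x = 2 * inner ℝ (cov X x (W x)) (W x) := by
  rw [lieDerivMetric, hcov.mvfderiv_inner hW hW, hcov.mlieBracket_eq hX hW hXv hWv,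
    inner_sub_left, inner_sub_right, real_inner_comm (W x) (cov X x (W x))]
  ring

lemma vertDiv_eq_sum (hX : SmoothNear X x) (hXv : X x ∈ F.vert x)
    {z : Fin m → TangentSpace 𝓘(ℝ, E) x} (hz : Orthonormal ℝ z)
    (hspan : Submodule.span ℝ (Set.range z) = F.vert x) :
    F.vertDiv X x = ∑ a, inner ℝ (cov X x (z a)) (z a) := by
  have h : ∀ e ∈ F.vert x, lieDerivMetric X (FiberBundle.extend E e) (FiberBundle.extend E e) x =
      2 * inner ℝ (cov X x e) e := by
    intro e he
    have := hcov.lieDerivMetric_self hX hXv (smoothNear_extend e) (by simpa using he)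
    simpa using this
  have hsum := sum_bilin_orthonormalBasis_submodule hz hspan (stdOrthonormalBasis ℝ (F.vert x))
    (innerₗ (TangentSpace 𝓘(ℝ, E) x) ∘ₗ (cov X x : _ →ₗ[ℝ] _))
  rw [Foliation.vertDiv, Finset.sum_congr rfl fun i _ ↦
    h _ (stdOrthonormalBasis ℝ (F.vert x) i).2, ← Finset.mul_sum]
  simp only [LinearMap.comp_apply, innerₗ_apply_apply, ContinuousLinearMap.coe_coe] at hsum
  rw [← hsum]
  ring

/-- For vertical `U`, `V`, metricity gives `⟨∇_U X, V⟩ = U(Vf) - ⟨X, ∇_U V⟩`, where `X` is the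
vertical gradient. The antisymmetric part is `[U, V]f - ⟨X, ∇_U V - ∇_V U⟩`, zero because the
torsion vanishes and the bracket is vertical. -/
lemma inner_cov_vertGrad_symm (hf : SmoothFunNear (E := E) f x) {u v : TangentSpace 𝓘(ℝ, E) x}
    (hu : u ∈ F.vert x) (hv : v ∈ F.vert x) :
    inner ℝ (cov (F.vertGrad f) x u) v = inner ℝ (cov (F.vertGrad f) x v) u := by
  obtain ⟨U, hU, hUv, rfl⟩ := F.exists_vertical_extension hu
  obtain ⟨V, hV, hVv, rfl⟩ := F.exists_vertical_extension hv
  have hX := F.smoothNear_vertGrad hf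
  have key : ∀ {U V : Π x : M, TangentSpace 𝓘(ℝ, E) x}, SmoothNear V x →
      (∀ᶠ y in 𝓝 x, V y ∈ F.vert y) →
      inner ℝ (cov (F.vertGrad f) x (U x)) (V x) + inner ℝ (F.vertGrad f x) (cov V x (U x)) =
        mvfderiv 𝓘(ℝ, E) (fun y ↦ mvfderiv 𝓘(ℝ, E) f y (V y)) x (U x) := by
    intro U V hV hVv
    rw [← hcov.mvfderiv_inner hX hV]
    refine mvfderiv_congr ?_ _
    filter_upwards [hVv] with y hy using F.inner_vertGrad f hy
  have h1 := key (U := U) hV hVv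
  have h2 := key (U := V) hU hUv
  have h3 := mvfderiv_mlieBracket hf hU hV
  have hbr := hcov.mlieBracket_eq hU hV hu hv
  rw [← h1, ← h2, ← F.inner_vertGrad f (hbr ▸ Submodule.sub_mem _ (hcov.cov_mem_vert hV hVv _)
    (hcov.cov_mem_vert hU hUv _)), hbr, inner_sub_right] at h3
  linarith

/-- For vertical `v`, `v|X|² = 2⟨∇_v X, X⟩ = 2⟨∇_X X, v⟩` by symmetry of the vertical Hessian. -/
lemma vertGrad_gamma (hf : SmoothFunNear (E := E) f x) :
    F.vertGrad (F.gamma f f) x = (2 : ℝ) • cov (F.vertGrad f) x (F.vertGrad f x) := by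
  have hX := F.smoothNear_vertGrad hf
  have hmem := hcov.cov_mem_vert hX (Filter.Eventually.of_forall fun y ↦ F.vertGrad_mem f y)
  have hsub : F.vertGrad (F.gamma f f) x -
      (2 : ℝ) • cov (F.vertGrad f) x (F.vertGrad f x) ∈ F.vert x :=
    Submodule.sub_mem _ (F.vertGrad_mem _ _) (Submodule.smul_mem _ _ (hmem _))
  have key : ∀ v ∈ F.vert x, inner ℝ (F.vertGrad (F.gamma f f) x -
      (2 : ℝ) • cov (F.vertGrad f) x (F.vertGrad f x)) v = 0 := by
    intro v hv
    have h1 : mvfderiv 𝓘(ℝ, E) (F.gamma f f) x v = _ := hcov.mvfderiv_inner hX hX v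
    rw [inner_sub_left, F.inner_vertGrad _ hv, h1, real_inner_smul_left,
      ← hcov.inner_cov_vertGrad_symm hf hv (F.vertGrad_mem f x),
      real_inner_comm (F.vertGrad f x) (cov (F.vertGrad f) x v)]
    ring
  -- The difference is vertical and orthogonal to all vertical vectors, hence to itself.
  exact sub_eq_zero.1 (inner_self_eq_zero.1 (key _ hsub))

lemma ricci_self_eq_sum (hX : SmoothNear X x) (hXv : ∀ᶠ y in 𝓝 x, X y ∈ F.vert y)
    (hZ : F.IsOrthonormalFrameNear Z x) :
    ricci cov x (X x) (X x) = ∑ a, inner ℝ (curvature cov (Z a) X X x) (Z a x) := by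
  have hext := fun w : TangentSpace 𝓘(ℝ, E) x ↦ smoothNear_extend w
  -- Linearity comes from tensoriality: the extension of a sum and the sum of the extensions agree
  -- at `x`.
  let L : TangentSpace 𝓘(ℝ, E) x →ₗ[ℝ] TangentSpace 𝓘(ℝ, E) x :=
    { toFun := fun w ↦ curvature cov (FiberBundle.extend E w) X X x
      map_add' := fun v w ↦ by
        rw [← (hcov.smoothTensorialAt_curvature_left hX).add (hext v) (hext w)]
        exact (hcov.smoothTensorialAt_curvature_left hX).pointwise (hext _)
          ((hext v).add (hext w)) (by simp)
      map_smul' := fun c w ↦ by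
        have hc : SmoothFunNear (E := E) (fun _ : M ↦ c) x :=
          Filter.Eventually.of_forall fun y ↦ contMDiffAt_const
        rw [RingHom.id_apply, ← (hcov.smoothTensorialAt_curvature_left hX).smul hc (hext w)]
        exact (hcov.smoothTensorialAt_curvature_left hX).pointwise (hext _)
          ((hext w).smul hc) (by simp) }
  have hL : ∀ w, L w ∈ F.vert x := fun w ↦ hcov.curvature_mem_vert (hext w) hX hX hXv
  have h1 := sum_inner_orthonormalBasis_of_range_le hZ.orthonormal.self_of_nhds
    hZ.span_eq.self_of_nhds (stdOrthonormalBasis ℝ (TangentSpace 𝓘(ℝ, E) x)) L hL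
  have h2 : ∀ w, curvature cov (FiberBundle.extend E w) (FiberBundle.extend E (X x))
      (FiberBundle.extend E (X x)) x = L w := fun w ↦
    hcov.curvature_congr (hext _) (hext _) (hext _) hX (hext _) hX rfl (by simp) (by simp)
  have h3 : ∀ a, curvature cov (Z a) X X x = L (Z a x) := fun a ↦
    (hcov.smoothTensorialAt_curvature_left hX).pointwise (hZ.smoothNear a) (hext _) (by simp)
  rw [ricci]
  simp only [h2, h3]
  exact h1

/-- Differentiate the constant `⟨Z_a, Z_b⟩ = δ_ab`. -/
lemma inner_cov_frame_antisymm (hZ : F.IsOrthonormalFrameNear Z x) (u : TangentSpace 𝓘(ℝ, E) x)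
    (a b : Fin m) : inner ℝ (cov (Z a) x u) (Z b x) = -inner ℝ (cov (Z b) x u) (Z a x) := by
  have h := hcov.mvfderiv_inner (hZ.smoothNear a) (hZ.smoothNear b) u
  have hconst : (fun y ↦ (inner ℝ (Z a y) (Z b y) : ℝ)) =ᶠ[𝓝 x]
      fun _ ↦ if a = b then (1 : ℝ) else 0 := by
    filter_upwards [hZ.orthonormal] with y hy using orthonormal_iff_ite.1 hy a b
  rw [mvfderiv_congr hconst, mvfderiv_const, real_inner_comm (cov (Z b) x u)] at h
  rw [eq_neg_iff_add_eq_zero, ← h]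
  rfl

/-- The vertical Laplacian in a local orthonormal frame. -/
lemma vertLaplacian_eventuallyEq (hf : SmoothFunNear (E := E) f x)
    (hZ : F.IsOrthonormalFrameNear Z x) : F.vertLaplacian f =ᶠ[𝓝 x]
      fun y ↦ ∑ a, inner ℝ (cov (F.vertGrad f) y (Z a y)) (Z a y) := by
  filter_upwards [hf.eventually_nhds, hZ.orthonormal, hZ.span_eq] with y h1 h2 h3
  exact hcov.vertDiv_eq_sum (F.smoothNear_vertGrad h1) (F.vertGrad_mem f y) h2 h3

lemma smoothFunNear_vertLaplacian_frame (hf : SmoothFunNear (E := E) f x)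
    (hZ : F.IsOrthonormalFrameNear Z x) (a : Fin m) : SmoothFunNear (E := E)
      (fun y ↦ inner ℝ (cov (F.vertGrad f) y (Z a y)) (Z a y)) x :=
  (hcov.smoothNear (hZ.smoothNear a) (F.smoothNear_vertGrad hf)).inner (hZ.smoothNear a)

/-- The Bochner formula along the leaves. -/
lemma bochner (hf : SmoothFunNear (E := E) f x) :
    (1 / 2) * F.vertLaplacian (F.gamma f f) x
      - mvfderiv 𝓘(ℝ, E) (F.vertLaplacian f) x (F.vertGrad f x) =
    F.vertHessianNormSq cov f x + ricci cov x (F.vertGrad f x) (F.vertGrad f x) := by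
  obtain ⟨Z, hZ⟩ := F.exists_isOrthonormalFrameNear x
  have hX := F.smoothNear_vertGrad hf
  have hXv : ∀ {x : M}, ∀ᶠ y in 𝓝 x, F.vertGrad f y ∈ F.vert y :=
    Filter.Eventually.of_forall fun y ↦ F.vertGrad_mem f y
  have hW := hcov.smoothNear hX hX
  have hon := hZ.orthonormal.self_of_nhds
  have hspan := hZ.span_eq.self_of_nhds
  have hZv := fun a ↦ (hZ.eventually_mem a).self_of_nhds
  have hgamma : F.vertGrad (F.gamma f f) =ᶠ[𝓝 x]
      (fun _ : M ↦ (2 : ℝ)) • fun y ↦ cov (F.vertGrad f) y (F.vertGrad f y) := by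
    filter_upwards [hf.eventually_nhds] with y hy using hcov.vertGrad_gamma hy
  have htwo : SmoothFunNear (E := E) (fun _ : M ↦ (2 : ℝ)) x :=
    Filter.Eventually.of_forall fun y ↦ contMDiffAt_const
  have hlap : F.vertLaplacian (F.gamma f f) x = 2 * ∑ a, inner ℝ
      (cov (fun y ↦ cov (F.vertGrad f) y (F.vertGrad f y)) x (Z a x)) (Z a x) := by
    rw [Foliation.vertLaplacian, hcov.vertDiv_eq_sum ((hW.smul htwo).congr hgamma)
      (F.vertGrad_mem _ x) hon hspan, Finset.mul_sum]
    refine Finset.sum_congr rfl fun a _ ↦ ?_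
    rw [(hW.smul htwo).cov_congr hgamma, hW.cov_smul htwo, mvfderiv_const,
      ← real_inner_smul_left]
    simp
  have hdlap : mvfderiv 𝓘(ℝ, E) (F.vertLaplacian f) x (F.vertGrad f x) =
      ∑ a, (inner ℝ (cov (fun y ↦ cov (F.vertGrad f) y (Z a y)) x (F.vertGrad f x)) (Z a x)
        + inner ℝ (cov (F.vertGrad f) x (Z a x)) (cov (Z a) x (F.vertGrad f x))) := by
    rw [mvfderiv_congr (hcov.vertLaplacian_eventuallyEq hf hZ), mvfderiv_sum_apply _
      fun a _ ↦ hcov.smoothFunNear_vertLaplacian_frame hf hZ a]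
    exact Finset.sum_congr rfl fun a _ ↦
      hcov.mvfderiv_inner (hcov.smoothNear (hZ.smoothNear a) hX) (hZ.smoothNear a) _
  -- Here `A = ∇X` and `D a = ∇_X Z_a`, so that `A (Z_a) - D a = [Z_a, X]`.
  have halg := sum_inner_sub_eq_sum_sq hon hspan (cov (F.vertGrad f) x : _ →ₗ[ℝ] _)
    (fun u ↦ hcov.cov_mem_vert hX hXv u)
    (fun a b ↦ hcov.inner_cov_vertGrad_symm hf (hZv a) (hZv b))
    (D := fun a ↦ cov (Z a) x (F.vertGrad f x))
    (fun a ↦ hcov.cov_mem_vert (hZ.smoothNear a) (hZ.eventually_mem a) _)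
    (fun a b ↦ hcov.inner_cov_frame_antisymm hZ _ a b)
  rw [hlap, hdlap, hcov.ricci_self_eq_sum hX hXv hZ, F.vertHessianNormSq_eq_sum hon hspan]
  simp only [ContinuousLinearMap.coe_coe] at halg
  rw [← halg, ← mul_assoc, one_div, inv_mul_cancel₀ two_ne_zero, one_mul,
    ← Finset.sum_sub_distrib, ← Finset.sum_add_distrib]
  refine Finset.sum_congr rfl fun a _ ↦ ?_
  rw [curvature, hcov.mlieBracket_eq (hZ.smoothNear a) hX (hZv a) (F.vertGrad_mem f x)]
  simp only [inner_sub_left]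
  ring

/-- The commutation of `Y` with the vertical gradient. -/
lemma mvfderiv_mvfderiv_vertGrad (hf : SmoothFunNear (E := E) f x) (hY : SmoothNear Y x) :
    mvfderiv 𝓘(ℝ, E) (fun y ↦ mvfderiv 𝓘(ℝ, E) f y (Y y)) x (F.vertGrad f x) =
      inner ℝ (cov Y x (F.vertGrad f x)) (gradient f x)
      + inner ℝ (cov.torsion x (Y x) (F.vertGrad f x)) (gradient f x)
      + inner ℝ (cov (F.vertGrad f) x (Y x)) (F.vertGrad f x) := by
  have hX := F.smoothNear_vertGrad hf
  have hXv : ∀ᶠ y in 𝓝 x, F.vertGrad f y ∈ F.vert y :=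
    Filter.Eventually.of_forall fun y ↦ F.vertGrad_mem f y
  have h1 := mvfderiv_mlieBracket hf hY hX
  have h2 : (fun y ↦ mvfderiv 𝓘(ℝ, E) f y (F.vertGrad f y)) = F.gamma f f := by
    ext1 y
    exact (F.gamma_eq f f y).symm
  have h3 : mvfderiv 𝓘(ℝ, E) (F.gamma f f) x (Y x) = _ := hcov.mvfderiv_inner hX hX (Y x)
  -- Since `∇_Y X` is vertical, pairing it with `∇f` or with `X` gives the same number.
  have h4 := F.inner_vertGrad f (hcov.cov_mem_vert hX hXv (Y x))
  rw [h2, h3] at h1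
  rw [cov.torsion_apply hY.mdifferentiableAt hX.mdifferentiableAt, real_inner_comm,
    inner_gradient, real_inner_comm (gradient f x), inner_gradient, map_sub, map_sub, h1, ← h4,
    real_inner_comm (F.vertGrad f x) (cov (F.vertGrad f) x (Y x))]
  ring

end Foliation.IsHladkyConnection
end Bochner

end KolmogorovFoliation

/-! ### The formula for `Γ₂`. -/

open KolmogorovFoliation in
theorem proposition2p2
    {E : Type*} [NormedAddCommGroup E] [NormedSpace ℝ E] [FiniteDimensional ℝ E]
    {M : Type*} [TopologicalSpace M] [T2Space M] [SecondCountableTopology M]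
    [ChartedSpace E M] [IsManifold 𝓘(ℝ, E) ∞ M]
    [RiemannianBundle (fun x : M ↦ TangentSpace 𝓘(ℝ, E) x)]
    [IsContMDiffRiemannianBundle 𝓘(ℝ, E) ∞ E (fun x : M ↦ TangentSpace 𝓘(ℝ, E) x)]
    {n m : ℕ} (hdim : Module.finrank ℝ E = n + m)
    (F : Foliation E M n m)
    (cov : CovariantDerivative 𝓘(ℝ, E) E (TangentSpace 𝓘(ℝ, E) : M → Type _))
    (hcov : F.IsHladkyConnection cov)
    (Y : Π x : M, TangentSpace 𝓘(ℝ, E) x) (hY : CMDiff ∞ (T% Y))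
    (f : M → ℝ) (hf : CMDiff ∞ f) (x : M) :
    F.gamma₂ Y f f x
      = F.vertHessianNormSq cov f x
        + ricci cov x (F.vertGrad f x) (F.vertGrad f x)
        - inner ℝ (cov Y x (F.vertGrad f x)) (gradient f x)
        - inner ℝ (cov.torsion x (Y x) (F.vertGrad f x)) (gradient f x) := by
  have hfx : SmoothFunNear (E := E) f x := Filter.Eventually.of_forall fun y ↦ hf y
  have hYx : SmoothNear Y x := Filter.Eventually.of_forall fun y ↦ hY y
  have hX := F.smoothNear_vertGrad hfx
  obtain ⟨Z, hZ⟩ := F.exists_isOrthonormalFrameNear x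
  -- Differentiability of `Δ_𝒱 f` is needed to split the derivative of `ℒ f` into its two terms.
  have hlap : SmoothFunNear (E := E) (F.vertLaplacian f) x := by
    filter_upwards [SmoothFunNear.sum Finset.univ fun a _ ↦
      hcov.smoothFunNear_vertLaplacian_frame hfx hZ a,
      (hcov.vertLaplacian_eventuallyEq hfx hZ).eventuallyEq_nhds] with y h1 h2
    exact h1.congr_of_eventuallyEq h2
  have hL : F.gamma f (F.kolmogorov Y f) x =
      mvfderiv 𝓘(ℝ, E) (F.vertLaplacian f) x (F.vertGrad f x) +
      mvfderiv 𝓘(ℝ, E) (fun y ↦ mvfderiv 𝓘(ℝ, E) f y (Y y)) x (F.vertGrad f x) := by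
    rw [F.gamma_eq]
    have : F.kolmogorov Y f = fun y ↦ F.vertLaplacian f y + mvfderiv 𝓘(ℝ, E) f y (Y y) := rfl
    rw [this, mvfderiv_fun_add hlap.mdifferentiableAt (hfx.mvfderiv hYx).mdifferentiableAt]
    rfl
  have hgY : mvfderiv 𝓘(ℝ, E) (F.gamma f f) x (Y x) = _ := hcov.mvfderiv_inner hX hX (Y x)
  have hb := hcov.bochner hfx
  have hc := hcov.mvfderiv_mvfderiv_vertGrad hfx hYx
  -- By metricity `½ Y Γ(f, f) = ⟨∇_Y X, X⟩`, which cancels the same term in `hc`.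
  rw [Foliation.gamma₂, hL, Foliation.kolmogorov, hgY,
    real_inner_comm (cov (F.vertGrad f) x (Y x)) (F.vertGrad f x)]
  linarith
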